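/- Let $(X_k)_{k\ge 1}$ be a standardized Gaussian process on a probability space: for every finite set of indices the joint distribution of the corresponding variables is multivariate Gaussian (possibly degenerate), and $X_k\sim\mathcal N(0,1)$ for every $k$. Let $\Phi$ be the cumulative distribution function of $\mathcal N(0,1)$ and put $$\widehat F_n(t)=\frac1n\sum_{i=1}^n \mathbf 1(\Phi(X_i)\le t)\quad(t\in\mathbb R),\qquad \Delta(n)=2\sum_{1\le i<j\le n}|\operatorname{Cov}(X_i,X_j)|.$$ Suppose there is a function $r:\{0,1,2,\dots\}\to\mathbb R$ with $\lim_{x\to\infty}r(x)=0$ and $|\mathbf E X_iX_j|\le r(|i-j|)$ for all $i,j\ge 1$. Then $\Delta(n)=o(n^2)$ as $n\to\infty$, and $$\sup_{t\in\mathbb R}\bigl|\widehat F_n(t)-\mathbf E\widehat F_n(t)\bigr|\longrightarrow 0\quad\text{in probability as } n\to\infty.$$ -/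

import Mathlib

open MeasureTheory ProbabilityTheory Filter Topology Asymptotics

/-- A standardized Gaussian process: all finite-dimensional distributions are multivariate
Gaussian (possibly degenerate) and every marginal is `N(0, 1)`. The variables `X_1, X_2, …` are
enumerated from `0`, so `X i` is the `(i + 1)`-st variable. -/
structure IsStandardizedGaussianProcess {Ω : Type*} [MeasurableSpace Ω]
    (X : ℕ → Ω → ℝ) (P : Measure Ω) : Prop where
  isGaussianProcess : IsGaussianProcess X P
  hasLaw : ∀ k, HasLaw (X k) (gaussianReal 0 1) P

/-- The cumulative distribution function `Φ` of the standard Gaussian. -/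
noncomputable def stdGaussianCDF (x : ℝ) : ℝ := cdf (gaussianReal 0 1) x

/-- The empirical distribution function
`F̂_n(t) = (1/n) ∑_{i = 1}^n 1(Φ(X_i) ≤ t)` of the first `n` variables. -/
noncomputable def empiricalDF {Ω : Type*} (X : ℕ → Ω → ℝ) (n : ℕ) (t : ℝ) (ω : Ω) : ℝ :=
  (1 / (n : ℝ)) * ∑ i ∈ Finset.range n, Set.indicator {x : ℝ | stdGaussianCDF x ≤ t} 1 (X i ω)

/-- The uniform deviation `sup_t |F̂_n(t) - E F̂_n(t)|`, a function on the sample space. -/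
noncomputable def uniformDeviation {Ω : Type*} [MeasurableSpace Ω]
    (X : ℕ → Ω → ℝ) (P : Measure Ω) (n : ℕ) (ω : Ω) : ℝ :=
  ⨆ t : ℝ, |empiricalDF X n t ω - ∫ ω', empiricalDF X n t ω' ∂P|

/-- The dependence measure `Δ(n) = 2 ∑_{i < j ≤ n} |Cov(X_i, X_j)|` of the first `n` variables. -/
noncomputable def dependenceMeasure {Ω : Type*} [MeasurableSpace Ω]
    (X : ℕ → Ω → ℝ) (P : Measure Ω) (n : ℕ) : ℝ :=
  2 * ∑ j ∈ Finset.range n, ∑ i ∈ Finset.range j, |cov[X i, X j; P]|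

theorem abs_empiricalDF_le_one {Ω : Type*} (X : ℕ → Ω → ℝ) (n : ℕ) (t : ℝ) (ω : Ω) :
    |empiricalDF X n t ω| ≤ 1 := by
  have h : ∀ i ∈ Finset.range n,
      |Set.indicator {x : ℝ | stdGaussianCDF x ≤ t} (1 : ℝ → ℝ) (X i ω)| ≤ 1 := by
    intro i _
    by_cases hx : X i ω ∈ {x : ℝ | stdGaussianCDF x ≤ t}
    · rw [Set.indicator_of_mem hx]; simp
    · rw [Set.indicator_of_notMem hx]; simp
  have h2 := (Finset.abs_sum_le_sum_abs _ _).trans (Finset.sum_le_sum h)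
  simp only [Finset.sum_const, Finset.card_range, nsmul_eq_mul, mul_one] at h2
  rw [empiricalDF, abs_mul, abs_of_nonneg (by positivity : (0 : ℝ) ≤ 1 / (n : ℝ))]
  calc (1 / (n : ℝ)) * _ ≤ (1 / (n : ℝ)) * n := by gcongr
    _ ≤ 1 := by rw [one_div]; exact inv_mul_le_one

/-- The supremum in `uniformDeviation` is over a bounded set, hence a genuine supremum. -/
theorem bddAbove_uniformDeviation {Ω : Type*} [MeasurableSpace Ω]
    (X : ℕ → Ω → ℝ) (P : Measure Ω) [IsProbabilityMeasure P] (n : ℕ) (ω : Ω) :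
    BddAbove (Set.range fun t : ℝ ↦
      |empiricalDF X n t ω - ∫ ω', empiricalDF X n t ω' ∂P|) := by
  refine ⟨1 + 1, ?_⟩
  rintro _ ⟨t, rfl⟩
  refine (abs_sub _ _).trans (add_le_add (abs_empiricalDF_le_one X n t ω) ?_)
  have h := norm_integral_le_of_norm_le_const (μ := P) (f := empiricalDF X n t) (C := 1)
    (Eventually.of_forall fun ω' ↦ abs_empiricalDF_le_one X n t ω')
  simpa using h

/-! The argument is Chebyshev at fixed `t`, then a Glivenko–Cantelli grid argument. It suffices that
indicators of the events `X_i ≤ x` and `X_j ≤ x` have covariance vanishing as `|i - j| → ∞`: a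
Cesàro average then sends the variance of the empirical function to `0`.

The covariance bound (`abs_covariance_indicator_Iic_le`) comes from decoupling. With `ρ` the
covariance of `X` and `Y`, the residual `W = Y - ρX` is independent of `X`, and replacing `Y` by `W`
changes the indicator only if `Y` is near `x` or `ρX` is large. No joint density is used, so
degenerate pairs are covered.

Since `Φ(X_i)` is uniform, the mean of the empirical function is `t` on `[0, 1]`, and monotonicity
passes from a finite grid to all `t`. -/

/-! ### Cesàro averages and the grid argument -/

section Averages

/-- Each distance to `j` is attained at most once on either side of `j`. -/
theorem sum_range_natAbs_sub_le {b : ℕ → ℝ} (hb : ∀ k, 0 ≤ b k) {n j : ℕ} (hj : j < n) :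
    ∑ i ∈ Finset.range n, b ((i : ℤ) - (j : ℤ)).natAbs ≤ 2 * ∑ k ∈ Finset.range n, b k := by
  have hsplit := Finset.sum_filter_add_sum_filter_not (Finset.range n) (fun i ↦ i ≤ j)
    (fun i ↦ b ((i : ℤ) - (j : ℤ)).natAbs)
  have h1 : ∑ i ∈ Finset.range n with i ≤ j, b ((i : ℤ) - (j : ℤ)).natAbs
      ≤ ∑ k ∈ Finset.range n, b k := by
    rw [← Finset.sum_image (f := b) (g := fun i : ℕ ↦ ((i : ℤ) - (j : ℤ)).natAbs)]
    · refine Finset.sum_le_sum_of_subset_of_nonneg ?_ fun k _ _ ↦ hb k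
      intro k hk
      simp only [Finset.mem_image, Finset.mem_filter, Finset.mem_range] at hk ⊢
      omega
    · intro a ha c hc h
      simp only [Finset.coe_filter, Finset.mem_range, Set.mem_ofPred_eq] at ha hc h
      omega
  have h2 : ∑ i ∈ Finset.range n with ¬ i ≤ j, b ((i : ℤ) - (j : ℤ)).natAbs
      ≤ ∑ k ∈ Finset.range n, b k := by
    rw [← Finset.sum_image (f := b) (g := fun i : ℕ ↦ ((i : ℤ) - (j : ℤ)).natAbs)]
    · refine Finset.sum_le_sum_of_subset_of_nonneg ?_ fun k _ _ ↦ hb k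
      intro k hk
      simp only [Finset.mem_image, Finset.mem_filter, Finset.mem_range] at hk ⊢
      omega
    · intro a ha c hc h
      simp only [Finset.coe_filter, Finset.mem_range, Set.mem_ofPred_eq] at ha hc h
      omega
  linarith

/-- The mean of an array whose entries are dominated by a null sequence of the distance to the
diagonal tends to `0`. -/
theorem tendsto_mean_double_sum_zero {a : ℕ → ℕ → ℝ} {b : ℕ → ℝ} (hb : Tendsto b atTop (𝓝 0))
    (hab : ∀ i j : ℕ, |a i j| ≤ b ((i : ℤ) - (j : ℤ)).natAbs) :
    Tendsto (fun n : ℕ ↦ (1 / (n : ℝ)) ^ 2 *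
      ∑ j ∈ Finset.range n, ∑ i ∈ Finset.range n, |a i j|) atTop (𝓝 0) := by
  have hb0 : ∀ k, 0 ≤ b k := fun k ↦ (abs_nonneg _).trans (by simpa using hab k 0)
  have hlim : Tendsto (fun n : ℕ ↦ 2 * ((n⁻¹ : ℝ) * ∑ k ∈ Finset.range n, b k)) atTop (𝓝 0) := by
    simpa using hb.cesaro.const_mul 2
  refine squeeze_zero (fun n ↦ by positivity) (fun n ↦ ?_) hlim
  have h : ∑ j ∈ Finset.range n, ∑ i ∈ Finset.range n, |a i j|
      ≤ n * (2 * ∑ k ∈ Finset.range n, b k) := by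
    refine (Finset.sum_le_card_nsmul _ _ _ fun j hj ↦ ?_).trans_eq
      (by rw [Finset.card_range, nsmul_eq_mul])
    exact (Finset.sum_le_sum fun i _ ↦ hab i j).trans
      (sum_range_natAbs_sub_le hb0 (Finset.mem_range.1 hj))
  rcases Nat.eq_zero_or_pos n with rfl | hn
  · simp
  have hn' : (0 : ℝ) < n := by exact_mod_cast hn
  calc (1 / (n : ℝ)) ^ 2 * _ ≤ (1 / (n : ℝ)) ^ 2 * (n * (2 * ∑ k ∈ Finset.range n, b k)) := by
        gcongr
    _ = _ := by field_simp

/-- Monotone functions that agree outside `[0, 1)` are uniformly close if they are close on an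
equidistant grid on which one of them has small increments. -/
theorem abs_sub_le_of_grid {F G : ℝ → ℝ} (hF : Monotone F) (hG : Monotone G)
    (h0 : ∀ t < 0, F t = G t) (h1 : ∀ t, 1 ≤ t → F t = G t) {m : ℕ} (hm : 0 < m) {ε δ : ℝ}
    (hε : 0 ≤ ε) (hδ : 0 ≤ δ)
    (hFG : ∀ k ≤ m, |F ((k : ℝ) / m) - G ((k : ℝ) / m)| ≤ ε)
    (hinc : ∀ k < m, G (((k + 1 : ℕ) : ℝ) / m) - G ((k : ℝ) / m) ≤ δ) (t : ℝ) :
    |F t - G t| ≤ ε + δ := by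
  have hm' : (0 : ℝ) < m := by exact_mod_cast hm
  rcases lt_or_ge t 0 with ht0 | ht0
  · rw [h0 t ht0]; simpa using add_nonneg hε hδ
  rcases le_or_gt 1 t with ht1 | ht1
  · rw [h1 t ht1]; simpa using add_nonneg hε hδ
  set k := ⌊t * m⌋₊ with hk
  have hkm : k < m := by
    rw [hk, Nat.floor_lt (by positivity)]
    nlinarith
  have hl : (k : ℝ) / m ≤ t := by
    rw [div_le_iff₀ hm']
    exact Nat.floor_le (by positivity)
  have hu : t ≤ ((k + 1 : ℕ) : ℝ) / m := by
    rw [le_div_iff₀ hm']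
    push_cast
    exact (Nat.lt_floor_add_one _).le
  have e1 := abs_le.1 (hFG k hkm.le)
  have e2 := abs_le.1 (hFG (k + 1) hkm)
  have e3 := hinc k hkm
  have := hF hl
  have := hF hu
  have := hG hl
  have := hG hu
  rw [abs_le]
  constructor <;> linarith

end Averages

/-! ### The standard Gaussian distribution function -/

section StdGaussianCDF

instance : (gaussianReal 0 1).IsOpenPosMeasure :=
  (gaussianReal_absolutelyContinuous' 0 one_ne_zero).isOpenPosMeasure

instance : NullSingletonClass (gaussianReal 0 1) := nullSingletonClass_gaussianReal one_ne_zero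

theorem stdGaussianCDF_eq_real (x : ℝ) :
    stdGaussianCDF x = (gaussianReal 0 1).real (Set.Iic x) := cdf_eq_real _ x

theorem strictMono_stdGaussianCDF : StrictMono stdGaussianCDF := by
  intro x y hxy
  rw [stdGaussianCDF_eq_real, stdGaussianCDF_eq_real, ← Set.Iic_union_Ioc_eq_Iic hxy.le,
    measureReal_union (Set.Iic_disjoint_Ioc le_rfl) measurableSet_Ioc]
  have : 0 < (gaussianReal 0 1).real (Set.Ioc x y) := by
    refine ENNReal.toReal_pos (ne_of_gt ?_) (measure_ne_top _ _)
    exact ((Measure.measure_Ioo_pos _).2 hxy).trans_le (measure_mono Set.Ioo_subset_Ioc_self)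
  linarith

/-- The intervals shrink to a point, which is null. This serves both the continuity of `Φ` and the
covariance bound. -/
theorem tendsto_measureReal_Icc_zero {μ : Measure ℝ} [IsFiniteMeasure μ] [NullSingletonClass μ] (x : ℝ)
    {ι : Type*} {l : Filter ι} {η : ι → ℝ} (hη : Tendsto η l (𝓝 0)) :
    Tendsto (fun k ↦ μ.real (Set.Icc (x - η k) (x + η k))) l (𝓝 0) := by
  simpa [Function.comp_def, measureReal_def] using
    (ENNReal.tendsto_toReal ENNReal.zero_ne_top).comp ((tendsto_measure_Icc μ x).comp hη)

theorem continuous_stdGaussianCDF : Continuous stdGaussianCDF := by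
  refine continuous_iff_continuousAt.2 fun x ↦ tendsto_iff_dist_tendsto_zero.2 ?_
  have hη : Tendsto (fun y ↦ |y - x|) (𝓝 x) (𝓝 0) := by
    simpa using ((continuous_id.sub continuous_const).abs.tendsto x :
      Tendsto (fun y : ℝ ↦ |y - x|) (𝓝 x) _)
  refine squeeze_zero (fun _ ↦ dist_nonneg) (fun y ↦ ?_)
    (tendsto_measureReal_Icc_zero (μ := gaussianReal 0 1) x hη)
  have h1 := le_abs_self (y - x)
  have h2 := neg_abs_le (y - x)
  have hle : ∀ a b : ℝ, Set.Iic a ⊆ Set.Iic b ∪ Set.Icc (x - |y - x|) (x + |y - x|) →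
      stdGaussianCDF a - stdGaussianCDF b ≤
        (gaussianReal 0 1).real (Set.Icc (x - |y - x|) (x + |y - x|)) := fun a b h ↦ by
    rw [sub_le_iff_le_add', stdGaussianCDF_eq_real, stdGaussianCDF_eq_real]
    exact (measureReal_mono h).trans (measureReal_union_le _ _)
  rw [Real.dist_eq, abs_sub_le_iff]
  constructor
  all_goals
    refine hle _ _ fun z hz ↦ (le_or_gt z _).imp id fun hz' ↦ ?_
    simp only [Set.mem_Iic] at hz
    constructor <;> linarith [abs_nonneg (y - x)]

theorem stdGaussianCDF_pos (x : ℝ) : 0 < stdGaussianCDF x :=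
  (cdf_nonneg _ (x - 1)).trans_lt (strictMono_stdGaussianCDF (by linarith))

theorem stdGaussianCDF_lt_one (x : ℝ) : stdGaussianCDF x < 1 :=
  (strictMono_stdGaussianCDF (by linarith : x < x + 1)).trans_le (cdf_le_one _ _)

theorem setOf_stdGaussianCDF_le_of_nonpos {t : ℝ} (ht : t ≤ 0) :
    {x | stdGaussianCDF x ≤ t} = ∅ :=
  Set.eq_empty_of_forall_notMem fun x hx ↦ (stdGaussianCDF_pos x).not_ge (le_trans hx ht)

theorem setOf_stdGaussianCDF_le_of_one_le {t : ℝ} (ht : 1 ≤ t) :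
    {x | stdGaussianCDF x ≤ t} = Set.univ :=
  Set.eq_univ_of_forall fun x ↦ (stdGaussianCDF_lt_one x).le.trans ht

theorem exists_setOf_stdGaussianCDF_le_eq_Iic {t : ℝ} (h0 : 0 < t) (h1 : t < 1) :
    ∃ x, stdGaussianCDF x = t ∧ {y | stdGaussianCDF y ≤ t} = Set.Iic x := by
  obtain ⟨a, ha⟩ := ((tendsto_cdf_atBot (gaussianReal 0 1)).eventually (gt_mem_nhds h0)).exists
  obtain ⟨b, hb⟩ := ((tendsto_cdf_atTop (gaussianReal 0 1)).eventually (lt_mem_nhds h1)).exists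
  obtain ⟨x, hx⟩ := mem_range_of_exists_le_of_exists_ge continuous_stdGaussianCDF
    ⟨a, ha.le⟩ ⟨b, hb.le⟩
  refine ⟨x, hx, ?_⟩
  ext y
  rw [Set.mem_ofPred_eq, ← hx, strictMono_stdGaussianCDF.le_iff_le, Set.mem_Iic]

theorem measurableSet_setOf_stdGaussianCDF_le (t : ℝ) :
    MeasurableSet {x | stdGaussianCDF x ≤ t} :=
  measurableSet_le continuous_stdGaussianCDF.measurable measurable_const

/-- The probability integral transform: `Φ` maps the standard Gaussian to the uniform law. -/
theorem measureReal_setOf_stdGaussianCDF_le {t : ℝ} (h0 : 0 ≤ t) (h1 : t ≤ 1) :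
    (gaussianReal 0 1).real {x | stdGaussianCDF x ≤ t} = t := by
  rcases h0.eq_or_lt with rfl | h0
  · simp [setOf_stdGaussianCDF_le_of_nonpos le_rfl]
  rcases h1.eq_or_lt with rfl | h1
  · simp [setOf_stdGaussianCDF_le_of_one_le le_rfl]
  obtain ⟨x, hx, hs⟩ := exists_setOf_stdGaussianCDF_le_eq_Iic h0 h1
  rw [hs, ← stdGaussianCDF_eq_real, hx]

end StdGaussianCDF

/-! ### Decoupling a Gaussian pair -/

section Covariance

variable {Ω : Type*} [MeasurableSpace Ω] {P : Measure Ω} [IsProbabilityMeasure P]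

theorem abs_covariance_le_of_abs_le_one {U V : Ω → ℝ} (hU : AEStronglyMeasurable U P)
    (hU1 : ∀ ω, |U ω| ≤ 1) (hV : MemLp V 2 P) :
    |cov[U, V; P]| ≤ 2 * ∫ ω, |V ω| ∂P := by
  have hUp : MemLp U 2 P := MemLp.of_bound hU 1 (.of_forall hU1)
  have hVi : Integrable V P := hV.integrable one_le_two
  rw [covariance_eq_sub hUp hV]
  have h1 : |∫ ω, U ω * V ω ∂P| ≤ ∫ ω, |V ω| ∂P := by
    refine abs_integral_le_integral_abs.trans (integral_mono_of_nonneg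
      (.of_forall fun _ ↦ abs_nonneg _) hVi.abs (.of_forall fun ω ↦ ?_))
    simpa [abs_mul] using mul_le_mul_of_nonneg_right (hU1 ω) (abs_nonneg (V ω))
  have h2 : |∫ ω, U ω ∂P| ≤ 1 := by
    simpa using norm_integral_le_of_norm_le_const (μ := P) (f := U) (C := 1) (.of_forall hU1)
  have h3 : |∫ ω, V ω ∂P| ≤ ∫ ω, |V ω| ∂P := abs_integral_le_integral_abs
  have h4 : |(∫ ω, U ω ∂P) * ∫ ω, V ω ∂P| ≤ ∫ ω, |V ω| ∂P := by
    rw [abs_mul]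
    exact (mul_le_of_le_one_left (abs_nonneg _) h2).trans h3
  calc _ ≤ |∫ ω, U ω * V ω ∂P| + |(∫ ω, U ω ∂P) * ∫ ω, V ω ∂P| := abs_sub _ _
    _ ≤ _ := by linarith

/-- If the indicators differ, the threshold `x` separates `y` from `y - d`, so `|y - x| ≤ |d|`.
Either `|d| ≤ η` and `y` lies in the window, or `|d| > η` and the quadratic term exceeds `1`. -/
theorem abs_indicator_Iic_sub_le (x y d : ℝ) {η : ℝ} (hη : 0 < η) :
    |Set.indicator (Set.Iic x) (1 : ℝ → ℝ) y - Set.indicator (Set.Iic x) 1 (y - d)| ≤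
      Set.indicator (Set.Icc (x - η) (x + η)) 1 y + d ^ 2 / η ^ 2 := by
  have hd : 0 ≤ d ^ 2 / η ^ 2 := by positivity
  have hbig : η < |d| → 1 ≤ d ^ 2 / η ^ 2 := fun h ↦ by
    rw [one_le_div (by positivity), ← sq_abs d]
    gcongr
  simp only [Set.indicator_apply, Set.mem_Iic, Set.mem_Icc, Pi.one_apply]
  have := le_abs_self d
  have := neg_abs_le d
  rcases lt_or_ge η |d| with h | h
  · have := hbig h
    split_ifs <;> norm_num <;> linarith
  · split_ifs <;> norm_num <;> first | linarith | skip
    all_goals exfalso; simp only [not_and_or, not_le] at *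
    all_goals rcases ‹_ ∨ _› with h' | h' <;> linarith

theorem abs_covariance_indicator_Iic_le {X Y : Ω → ℝ}
    (hXY : HasGaussianLaw (fun ω ↦ (X ω, Y ω)) P)
    (hX : HasLaw X (gaussianReal 0 1) P) (hY : HasLaw Y (gaussianReal 0 1) P)
    (x : ℝ) {η : ℝ} (hη : 0 < η) :
    |cov[fun ω ↦ Set.indicator (Set.Iic x) (1 : ℝ → ℝ) (X ω),
        fun ω ↦ Set.indicator (Set.Iic x) (1 : ℝ → ℝ) (Y ω); P]| ≤
      2 * ((gaussianReal 0 1).real (Set.Icc (x - η) (x + η)) + cov[X, Y; P] ^ 2 / η ^ 2) := by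
  set ρ := cov[X, Y; P] with hρ
  set f : ℝ → ℝ := Set.indicator (Set.Iic x) 1 with hf
  have hfm : Measurable f := measurable_one.indicator measurableSet_Iic
  have hf1 : ∀ y, |f y| ≤ 1 := fun y ↦ by
    by_cases h : y ≤ x <;> simp [hf, h]
  have hXm := hX.aemeasurable
  have hYm := hY.aemeasurable
  have hX2 : MemLp X 2 P := hXY.fst.memLp_two
  have hY2 : MemLp Y 2 P := hXY.snd.memLp_two
  have hvar : Var[X; P] = 1 := by rw [hX.variance_eq]; simp
  have hmean : P[X] = 0 := by rw [hX.integral_eq]; simp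
  have hsq : ∫ ω, X ω ^ 2 ∂P = 1 := by
    rw [← hvar, variance_of_integral_eq_zero hXm hmean]
  -- The regression residual: uncorrelated with `X` because `Var X = 1`, hence independent by joint
  -- Gaussianity.
  let W : Ω → ℝ := fun ω ↦ Y ω - ρ * X ω
  have hWm : AEMeasurable W P := hYm.sub (hXm.const_mul ρ)
  have hXW : HasGaussianLaw (fun ω ↦ (X ω, W ω)) P :=
    hXY.map_fun ((ContinuousLinearMap.fst ℝ ℝ ℝ).prod
      (ContinuousLinearMap.snd ℝ ℝ ℝ - ρ • ContinuousLinearMap.fst ℝ ℝ ℝ))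
  have hcov : cov[X, W; P] = 0 := by
    have h := covariance_fun_sub_right (μ := P) hX2 hY2 (hX2.const_mul ρ)
    rw [covariance_const_mul_right, covariance_self hXm, hvar] at h
    rw [h]; ring
  have hind : IndepFun X W P := hXW.indepFun_of_covariance_eq_zero hcov
  have hmem : ∀ {Z : Ω → ℝ}, AEMeasurable Z P → MemLp (fun ω ↦ f (Z ω)) 2 P := fun hZ ↦
    MemLp.of_bound (hfm.comp_aemeasurable hZ).aestronglyMeasurable 1 (.of_forall fun _ ↦ hf1 _)
  have h0 : cov[fun ω ↦ f (X ω), fun ω ↦ f (W ω); P] = 0 :=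
    (hind.comp hfm hfm).covariance_eq_zero (hmem hXm) (hmem hWm)
  -- By independence, `f (Y)` may be replaced by `f (Y) - f (W)`, which is small in `L¹`.
  have h1 := covariance_fun_sub_right (μ := P) (hmem hXm) (hmem hYm) (hmem hWm)
  rw [h0, sub_zero] at h1
  rw [← h1]
  refine (abs_covariance_le_of_abs_le_one (hmem hXm).1 (fun _ ↦ hf1 _)
    ((hmem hYm).sub (hmem hWm))).trans ?_
  gcongr
  have hIcc : Measurable (Set.indicator (Set.Icc (x - η) (x + η)) (1 : ℝ → ℝ)) :=
    measurable_one.indicator measurableSet_Icc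
  have hi1 : Integrable (fun ω ↦ Set.indicator (Set.Icc (x - η) (x + η)) (1 : ℝ → ℝ) (Y ω)) P := by
    refine Integrable.of_bound (hIcc.comp_aemeasurable hYm).aestronglyMeasurable 1
      (.of_forall fun ω ↦ ?_)
    refine (norm_indicator_le_norm_self _ _).trans (by simp)
  have hi2 : Integrable (fun ω ↦ (ρ * X ω) ^ 2 / η ^ 2) P := by
    simpa [mul_pow] using (hX2.integrable_sq.const_mul (ρ ^ 2)).div_const (η ^ 2)
  calc ∫ ω, |f (Y ω) - f (W ω)| ∂P
      ≤ ∫ ω, (Set.indicator (Set.Icc (x - η) (x + η)) (1 : ℝ → ℝ) (Y ω) +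
          (ρ * X ω) ^ 2 / η ^ 2) ∂P :=
        integral_mono_of_nonneg (.of_forall fun _ ↦ abs_nonneg _) (hi1.add hi2)
          (.of_forall fun ω ↦ abs_indicator_Iic_sub_le x (Y ω) (ρ * X ω) hη)
    _ = _ := by
        rw [integral_add hi1 hi2, integral_div]
        congr 1
        · rw [← integral_indicator_one measurableSet_Icc]
          exact hY.integral_comp hIcc.aestronglyMeasurable
        · simp_rw [mul_pow]
          rw [integral_const_mul, hsq, mul_one]

end Covariance

/-! ### Variance and uniform convergence of the empirical function -/

section EmpiricalDF

variable {Ω : Type*}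

theorem monotone_empiricalDF (X : ℕ → Ω → ℝ) (n : ℕ) (ω : Ω) :
    Monotone fun t ↦ empiricalDF X n t ω := by
  intro s t hst
  simp only [empiricalDF]
  gcongr
  exact zero_le_one

theorem empiricalDF_of_nonpos (X : ℕ → Ω → ℝ) (n : ℕ) {t : ℝ} (ht : t ≤ 0) (ω : Ω) :
    empiricalDF X n t ω = 0 := by
  simp [empiricalDF, setOf_stdGaussianCDF_le_of_nonpos ht]

theorem empiricalDF_of_one_le (X : ℕ → Ω → ℝ) {n : ℕ} (hn : n ≠ 0) {t : ℝ} (ht : 1 ≤ t) (ω : Ω) :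
    empiricalDF X n t ω = 1 := by
  simp [empiricalDF, setOf_stdGaussianCDF_le_of_one_le ht, hn]

variable [MeasurableSpace Ω] {P : Measure Ω} {X : ℕ → Ω → ℝ} {r : ℕ → ℝ}

theorem covariance_eq_integral_mul (hX : IsStandardizedGaussianProcess X P) (i j : ℕ) :
    cov[X i, X j; P] = ∫ ω, X i ω * X j ω ∂P := by
  have hmean : ∀ k, P[X k] = 0 := fun k ↦ by rw [(hX.hasLaw k).integral_eq]; simp
  simp [covariance, hmean]

theorem dependenceMeasure_isLittleO (hr : Tendsto r atTop (𝓝 0))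
    (hcov : ∀ i j : ℕ, |cov[X i, X j; P]| ≤ r ((i : ℤ) - (j : ℤ)).natAbs) :
    (fun n : ℕ ↦ dependenceMeasure X P n) =o[atTop] (fun n : ℕ ↦ (n : ℝ) ^ 2) := by
  rw [isLittleO_iff_tendsto' ?_]
  · have h := (tendsto_mean_double_sum_zero hr hcov).const_mul 2
    rw [mul_zero] at h
    refine squeeze_zero (fun n ↦ ?_) (fun n ↦ ?_) h
    · rw [dependenceMeasure]; positivity
    · rw [dependenceMeasure, div_eq_mul_one_div, ← one_div_pow, mul_comm, mul_left_comm]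
      -- The triangle `i < j` is enlarged to the full square.
      gcongr with j hj
      exact (Finset.mem_range.1 hj).le
  · filter_upwards [eventually_ne_atTop 0] with n hn h
    exact absurd h (by positivity)

variable [IsProbabilityMeasure P]

theorem memLp_indicator_setOf_stdGaussianCDF_le (hX : ∀ k, HasLaw (X k) (gaussianReal 0 1) P)
    (t : ℝ) (k : ℕ) (p : ENNReal) :
    MemLp (fun ω ↦ Set.indicator {x : ℝ | stdGaussianCDF x ≤ t} (1 : ℝ → ℝ) (X k ω)) p P := by
  have hm : Measurable (Set.indicator {x : ℝ | stdGaussianCDF x ≤ t} (1 : ℝ → ℝ)) :=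
    measurable_one.indicator (measurableSet_setOf_stdGaussianCDF_le t)
  refine MemLp.of_bound (hm.comp_aemeasurable (hX k).aemeasurable).aestronglyMeasurable 1
    (.of_forall fun ω ↦ ?_)
  exact (norm_indicator_le_norm_self _ _).trans (by simp)

theorem memLp_empiricalDF (hX : ∀ k, HasLaw (X k) (gaussianReal 0 1) P) (n : ℕ) (t : ℝ)
    (p : ENNReal) : MemLp (empiricalDF X n t) p P :=
  (memLp_finsetSum _ fun k _ ↦ memLp_indicator_setOf_stdGaussianCDF_le hX t k p).const_mul _

theorem integral_empiricalDF (hX : ∀ k, HasLaw (X k) (gaussianReal 0 1) P) {n : ℕ} (hn : n ≠ 0)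
    {t : ℝ} (h0 : 0 ≤ t) (h1 : t ≤ 1) : ∫ ω, empiricalDF X n t ω ∂P = t := by
  have hm : Measurable (Set.indicator {x : ℝ | stdGaussianCDF x ≤ t} (1 : ℝ → ℝ)) :=
    measurable_one.indicator (measurableSet_setOf_stdGaussianCDF_le t)
  have hn' : (n : ℝ) ≠ 0 := by exact_mod_cast hn
  simp only [empiricalDF]
  rw [integral_const_mul, integral_finsetSum _ fun k _ ↦
    (memLp_indicator_setOf_stdGaussianCDF_le hX t k 1).integrable le_rfl]
  have h : ∀ k, ∫ ω, Set.indicator {x : ℝ | stdGaussianCDF x ≤ t} (1 : ℝ → ℝ) (X k ω) ∂P = t :=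
    fun k ↦ by
      refine ((hX k).integral_comp hm.aestronglyMeasurable).trans ?_
      rw [integral_indicator_one (measurableSet_setOf_stdGaussianCDF_le t),
        measureReal_setOf_stdGaussianCDF_le h0 h1]
  simp only [h, Finset.sum_const, Finset.card_range, nsmul_eq_mul]
  field_simp

theorem variance_empiricalDF_le (hX : ∀ k, HasLaw (X k) (gaussianReal 0 1) P) (n : ℕ) (t : ℝ) :
    Var[empiricalDF X n t; P] ≤ (1 / (n : ℝ)) ^ 2 *
      ∑ j ∈ Finset.range n, ∑ i ∈ Finset.range n,
        |cov[fun ω ↦ Set.indicator {x : ℝ | stdGaussianCDF x ≤ t} (1 : ℝ → ℝ) (X i ω),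
          fun ω ↦ Set.indicator {x : ℝ | stdGaussianCDF x ≤ t} (1 : ℝ → ℝ) (X j ω); P]| := by
  have h : Var[empiricalDF X n t; P] = (1 / (n : ℝ)) ^ 2 * _ := variance_const_mul _ _ _
  rw [h, variance_fun_sum' fun k _ ↦ memLp_indicator_setOf_stdGaussianCDF_le hX t k 2,
    Finset.sum_comm]
  gcongr
  exact le_abs_self _

theorem tendsto_variance_empiricalDF (hX : IsStandardizedGaussianProcess X P)
    (hr : Tendsto r atTop (𝓝 0))
    (hcov : ∀ i j : ℕ, |cov[X i, X j; P]| ≤ r ((i : ℤ) - (j : ℤ)).natAbs) (t : ℝ) :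
    Tendsto (fun n ↦ Var[empiricalDF X n t; P]) atTop (𝓝 0) := by
  suffices h : ∃ b : ℕ → ℝ, Tendsto b atTop (𝓝 0) ∧ ∀ i j : ℕ,
      |cov[fun ω ↦ Set.indicator {x : ℝ | stdGaussianCDF x ≤ t} (1 : ℝ → ℝ) (X i ω),
        fun ω ↦ Set.indicator {x : ℝ | stdGaussianCDF x ≤ t} (1 : ℝ → ℝ) (X j ω); P]| ≤
      b ((i : ℤ) - (j : ℤ)).natAbs by
    obtain ⟨b, hb, hab⟩ := h
    exact squeeze_zero (fun n ↦ variance_nonneg _ _) (variance_empiricalDF_le hX.hasLaw · t)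
      (tendsto_mean_double_sum_zero hb hab)
  rcases le_or_gt t 0 with h0 | h0
  · refine ⟨0, tendsto_const_nhds, fun i j ↦ ?_⟩
    simp [setOf_stdGaussianCDF_le_of_nonpos h0, covariance]
  rcases le_or_gt 1 t with h1 | h1
  · refine ⟨0, tendsto_const_nhds, fun i j ↦ ?_⟩
    simp [setOf_stdGaussianCDF_le_of_one_le h1, covariance]
  obtain ⟨x, -, hx⟩ := exists_setOf_stdGaussianCDF_le_eq_Iic h0 h1
  rw [hx]
  have hr0 : ∀ k, 0 ≤ r k := fun k ↦ (abs_nonneg _).trans (by simpa using hcov k 0)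
  -- The root gives `r k ≤ η k ^ 2`, so `ρ² / η² ≤ r k`; the second summand keeps `η` positive where
  -- `r` vanishes.
  let η : ℕ → ℝ := fun k ↦ √(r k) + 1 / ((k : ℝ) + 1)
  have hη0 : ∀ k, 0 < η k := fun k ↦ by positivity
  have hη : Tendsto η atTop (𝓝 0) := by
    simpa [η] using hr.sqrt.add (tendsto_one_div_add_atTop_nhds_zero_nat (𝕜 := ℝ))
  refine ⟨fun k ↦ 2 * ((gaussianReal 0 1).real (Set.Icc (x - η k) (x + η k)) + r k), ?_, ?_⟩
  · simpa using ((tendsto_measureReal_Icc_zero x hη).add hr).const_mul 2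
  · intro i j
    set k := ((i : ℤ) - (j : ℤ)).natAbs
    refine (abs_covariance_indicator_Iic_le hX.isGaussianProcess.hasGaussianLaw_prodMk
      (hX.hasLaw i) (hX.hasLaw j) x (hη0 k)).trans ?_
    refine mul_le_mul_of_nonneg_left (add_le_add_right ?_ _) zero_le_two
    rw [div_le_iff₀ (by have := hη0 k; positivity)]
    have e1 : cov[X i, X j; P] ^ 2 ≤ r k ^ 2 := by
      rw [← sq_abs]
      gcongr
      exact hcov i j
    have e2 : r k ≤ η k ^ 2 := by
      calc r k = √(r k) ^ 2 := (Real.sq_sqrt (hr0 k)).symm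
        _ ≤ η k ^ 2 := by
          gcongr
          exact le_add_of_nonneg_right (by positivity)
    calc _ ≤ r k ^ 2 := e1
      _ = r k * r k := sq _
      _ ≤ _ := mul_le_mul_of_nonneg_left e2 (hr0 k)

theorem tendsto_measure_empiricalDF_deviation (hX : IsStandardizedGaussianProcess X P)
    (hr : Tendsto r atTop (𝓝 0))
    (hcov : ∀ i j : ℕ, |cov[X i, X j; P]| ≤ r ((i : ℤ) - (j : ℤ)).natAbs) (t : ℝ)
    {ε : ℝ} (hε : 0 < ε) :
    Tendsto (fun n ↦ P {ω | ε ≤ |empiricalDF X n t ω - ∫ ω', empiricalDF X n t ω' ∂P|})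
      atTop (𝓝 0) := by
  have h := ENNReal.tendsto_ofReal
    ((tendsto_variance_empiricalDF hX hr hcov t).div_const (ε ^ 2))
  rw [zero_div, ENNReal.ofReal_zero] at h
  exact tendsto_of_tendsto_of_tendsto_of_le_of_le tendsto_const_nhds h (fun _ ↦ zero_le)
    fun n ↦ meas_ge_le_variance_div_sq (memLp_empiricalDF hX.hasLaw n t 2) hε

theorem uniformDeviation_nonneg (X : ℕ → Ω → ℝ) (P : Measure Ω) (n : ℕ) (ω : Ω) :
    0 ≤ uniformDeviation X P n ω :=
  Real.iSup_nonneg fun _ ↦ abs_nonneg _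

/-- The mean is the identity on `[0, 1]`, so its grid increments are exactly `1 / m`. -/
theorem uniformDeviation_le_of_grid (hX : ∀ k, HasLaw (X k) (gaussianReal 0 1) P) {n m : ℕ}
    (hn : n ≠ 0) (hm : 0 < m) {ω : Ω} {ε : ℝ} (hε : 0 ≤ ε)
    (h : ∀ k ≤ m, |empiricalDF X n ((k : ℝ) / m) ω -
      ∫ ω', empiricalDF X n ((k : ℝ) / m) ω' ∂P| ≤ ε) :
    uniformDeviation X P n ω ≤ ε + 1 / m := by
  have hm' : (0 : ℝ) < m := by exact_mod_cast hm
  refine ciSup_le fun t ↦ abs_sub_le_of_grid (F := fun t ↦ empiricalDF X n t ω)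
    (G := fun t ↦ ∫ ω', empiricalDF X n t ω' ∂P) (monotone_empiricalDF X n ω) ?_ ?_ ?_ hm hε
    (by positivity) h ?_ t
  · intro s t hst
    exact integral_mono ((memLp_empiricalDF hX n s 1).integrable le_rfl)
      ((memLp_empiricalDF hX n t 1).integrable le_rfl) fun ω' ↦ monotone_empiricalDF X n ω' hst
  · intro t ht
    simp [empiricalDF_of_nonpos X n ht.le]
  · intro t ht
    simp [empiricalDF_of_one_le X hn ht]
  · intro k hk
    have hk' : ((k + 1 : ℕ) : ℝ) ≤ m := by exact_mod_cast hk
    have hk'' : (k : ℝ) ≤ m := by exact_mod_cast hk.le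
    rw [integral_empiricalDF hX hn (by positivity) ((div_le_one hm').2 hk'),
      integral_empiricalDF hX hn (by positivity) ((div_le_one hm').2 hk'')]
    push_cast
    rw [← sub_div, add_sub_cancel_left]

theorem tendstoInMeasure_uniformDeviation (hX : IsStandardizedGaussianProcess X P)
    (hr : Tendsto r atTop (𝓝 0))
    (hcov : ∀ i j : ℕ, |cov[X i, X j; P]| ≤ r ((i : ℤ) - (j : ℤ)).natAbs) :
    TendstoInMeasure P (fun (n : ℕ) (ω : Ω) ↦ uniformDeviation X P n ω) atTop
      (fun _ ↦ (0 : ℝ)) := by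
  rw [tendstoInMeasure_iff_dist]
  intro ε hε
  obtain ⟨m, hm⟩ := exists_nat_one_div_lt (half_pos hε)
  have hsum : Tendsto (fun n ↦ ∑ k ∈ Finset.range (m + 1 + 1),
      P {ω | ε / 2 ≤ |empiricalDF X n ((k : ℝ) / (m + 1 : ℕ)) ω -
        ∫ ω', empiricalDF X n ((k : ℝ) / (m + 1 : ℕ)) ω' ∂P|}) atTop (𝓝 0) := by
    simpa using tendsto_finsetSum (Finset.range (m + 1 + 1)) fun k _ ↦
      tendsto_measure_empiricalDF_deviation hX hr hcov ((k : ℝ) / (m + 1 : ℕ)) (half_pos hε)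
  refine tendsto_of_tendsto_of_tendsto_of_le_of_le' tendsto_const_nhds hsum
    (.of_forall fun _ ↦ zero_le) ?_
  filter_upwards [eventually_ne_atTop 0] with n hn
  -- Monotonicity and subadditivity hold for arbitrary sets, so measurability of the supremum is not
  -- needed.
  refine (measure_mono ?_).trans (measure_biUnion_finset_le _ _)
  intro ω hω
  simp only [Set.mem_ofPred_eq, Real.dist_eq, sub_zero,
    abs_of_nonneg (uniformDeviation_nonneg X P n ω)] at hω
  by_contra hcon
  simp only [Set.mem_iUnion, Set.mem_ofPred_eq, Finset.mem_range, not_exists, not_le] at hcon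
  have := uniformDeviation_le_of_grid hX.hasLaw hn m.succ_pos (half_pos hε).le
    fun k hk ↦ (hcon k (Nat.lt_succ_of_le hk)).le
  push_cast at this
  linarith

end EmpiricalDF

theorem mainTheorem7 {Ω : Type*} [MeasurableSpace Ω] (P : Measure Ω) [IsProbabilityMeasure P]
    (X : ℕ → Ω → ℝ) (hX : IsStandardizedGaussianProcess X P)
    (r : ℕ → ℝ) (hr : Tendsto r atTop (𝓝 0))
    (hcov : ∀ i j : ℕ, |∫ ω, X i ω * X j ω ∂P| ≤ r ((i : ℤ) - (j : ℤ)).natAbs) :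
    (fun n : ℕ ↦ dependenceMeasure X P n) =o[atTop] (fun n : ℕ ↦ (n : ℝ) ^ 2) ∧
      TendstoInMeasure P (fun (n : ℕ) (ω : Ω) ↦ uniformDeviation X P n ω) atTop
        (fun _ ↦ (0 : ℝ)) := by
  have hcov' : ∀ i j : ℕ, |cov[X i, X j; P]| ≤ r ((i : ℤ) - (j : ℤ)).natAbs := fun i j ↦ by
    rw [covariance_eq_integral_mul hX]
    exact hcov i j
  exact ⟨dependenceMeasure_isLittleO hr hcov', tendstoInMeasure_uniformDeviation hX hr hcov'⟩
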